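/- Let $R$ be a commutative Noetherian henselian local ring and let $\mathrm{mod}\,R$ be the category of finitely generated $R$-modules. Let $\underline{\mathrm{mod}\,R}$ be its stable category: it has the same objects as $\mathrm{mod}\,R$, and its morphism groups are $\underline{\mathrm{Hom}}_R(X,Y)=\mathrm{Hom}_R(X,Y)/P(X,Y)$, where $P(X,Y)$ consists of the homomorphisms that factor through a projective module. Let $\mathrm{mod}(\underline{\mathrm{mod}\,R})$ be the category of finitely presented contravariant additive functors $F$ from $\underline{\mathrm{mod}\,R}$ to abelian groups (those that admit an exact sequence $\underline{\mathrm{Hom}}_R(-,X_1)\to\underline{\mathrm{Hom}}_R(-,X_0)\to F\to 0$ with $X_0,X_1$ in $\mathrm{mod}\,R$), with natural transformations as morphisms. Call a category quasi-Frobenius if it is abelian with enough projectives and all its projective objects are injective; call it Frobenius if it is abelian with enough projectives and enough injectives and its projective objects are exactly its injective objects. Then the following conditions are equivalent: 1. $\mathrm{mod}(\underline{\mathrm{mod}\,R})$ is a quasi-Frobenius category; 2. $\mathrm{mod}(\underline{\mathrm{mod}\,R})$ is a Frobenius category; 3. $R$ is an artinian Gorenstein ring (that is, $R$ is artinian and has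 finite injective dimension as a module over itself). -/

import Mathlib

open CategoryTheory

universe u v w

section StableCategory

variable (R : Type u) [CommRing R]

/-- A morphism of finitely generated modules factors through a (finitely generated) projective
module. -/
def FactorsThroughProjective {X Y : FGModuleCat.{u} R} (f : X ⟶ Y) : Prop :=
  ∃ (P : FGModuleCat.{u} R) (_ : Module.Projective R P) (a : X ⟶ P) (b : P ⟶ Y), a ≫ b = f

/-- Two morphisms of finitely generated modules are identified when their difference factors
through a projective module. -/
def stableRel : HomRel (FGModuleCat.{u} R) :=
  fun _ _ f g => FactorsThroughProjective R (f - g)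

variable {R}

theorem FactorsThroughProjective.zero (X Y : FGModuleCat.{u} R) :
    FactorsThroughProjective R (0 : X ⟶ Y) :=
  ⟨FGModuleCat.of R PUnit.{u + 1},
    inferInstanceAs (Module.Projective R PUnit.{u + 1}), 0, 0, by simp⟩

theorem FactorsThroughProjective.neg {X Y : FGModuleCat.{u} R} {f : X ⟶ Y}
    (hf : FactorsThroughProjective R f) : FactorsThroughProjective R (-f) := by
  obtain ⟨P, hP, a, b, rfl⟩ := hf
  exact ⟨P, hP, a, -b, by simp⟩

theorem FactorsThroughProjective.add {X Y : FGModuleCat.{u} R} {f g : X ⟶ Y}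
    (hf : FactorsThroughProjective R f) (hg : FactorsThroughProjective R g) :
    FactorsThroughProjective R (f + g) := by
  obtain ⟨P, hP, a, b, rfl⟩ := hf
  obtain ⟨Q, hQ, c, d, rfl⟩ := hg
  refine ⟨FGModuleCat.of R (P × Q), inferInstanceAs (Module.Projective R (P × Q)),
    FGModuleCat.ofHom (a.hom.hom.prod c.hom.hom),
    FGModuleCat.ofHom (b.hom.hom.coprod d.hom.hom), ?_⟩
  ext x
  rfl

theorem FactorsThroughProjective.comp_left {X Y Z : FGModuleCat.{u} R} (g : X ⟶ Y) {f : Y ⟶ Z}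
    (hf : FactorsThroughProjective R f) : FactorsThroughProjective R (g ≫ f) := by
  obtain ⟨P, hP, a, b, rfl⟩ := hf
  exact ⟨P, hP, g ≫ a, b, by simp⟩

theorem FactorsThroughProjective.comp_right {X Y Z : FGModuleCat.{u} R} {f : X ⟶ Y} (g : Y ⟶ Z)
    (hf : FactorsThroughProjective R f) : FactorsThroughProjective R (f ≫ g) := by
  obtain ⟨P, hP, a, b, rfl⟩ := hf
  exact ⟨P, hP, a, b ≫ g, by simp⟩

variable (R)

instance stableRel_congruence : Congruence (stableRel R) where
  comp_left f _ _ h := by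
    have := FactorsThroughProjective.comp_left f h
    rwa [Preadditive.comp_sub] at this
  comp_right g h := by
    have := FactorsThroughProjective.comp_right g h
    rwa [Preadditive.sub_comp] at this
  equivalence {X Y} :=
    { refl := fun f => by
        have := FactorsThroughProjective.zero X Y
        rwa [← sub_self f] at this
      symm := fun {f g} h => by
        have := FactorsThroughProjective.neg h
        rwa [neg_sub] at this
      trans := fun {f g k} h h' => by
        have := FactorsThroughProjective.add h h'
        rwa [sub_add_sub_cancel] at this }

/-- The stable category of the category `mod R` of finitely generated `R`-modules: its objects
are those of `mod R`, and `Hom(X, Y)` is `Hom_R(X, Y)` modulo the morphisms which factor through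
a projective module. -/
abbrev StableMod : Type (u + 1) := CategoryTheory.Quotient (stableRel R)

instance stableMod_preadditive : Preadditive (StableMod R) :=
  Quotient.preadditive (stableRel R) (fun _ _ f₁ f₂ g₁ g₂ hf hg => by
    have := FactorsThroughProjective.add hf hg
    rwa [← add_sub_add_comm] at this)

end StableCategory

section FunctorCategory

variable (A : Type v) [Category.{u} A] [Preadditive A]

/-- A contravariant additive functor `F` from `A` to abelian groups is finitely presented if there
is an exact sequence `Hom(-, X₁) ⟶ Hom(-, X₀) ⟶ F ⟶ 0`. -/
def IsFinitelyPresentedFunctor : ObjectProperty (Aᵒᵖ ⥤+ AddCommGrpCat.{u}) :=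
  fun F => ∃ (X₁ X₀ : A) (φ : preadditiveYoneda.obj X₁ ⟶ preadditiveYoneda.obj X₀)
    (π : preadditiveYoneda.obj X₀ ⟶ F.obj),
    ∀ Z : Aᵒᵖ, Function.Exact (φ.app Z) (π.app Z) ∧ Function.Surjective (π.app Z)

/-- The category `mod A` of finitely presented contravariant additive functors from `A` to
abelian groups, with all natural transformations as morphisms. -/
abbrev ModCat := (IsFinitelyPresentedFunctor A).FullSubcategory

end FunctorCategory

section Frobenius

variable (𝒜 : Type v) [Category.{w} 𝒜]

/-- A quasi-Frobenius category: an abelian category with enough projectives in which every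
projective object is injective. -/
structure IsQuasiFrobeniusCategory : Prop where
  abelian : Nonempty (Abelian 𝒜)
  enoughProjectives : EnoughProjectives 𝒜
  injective_of_projective : ∀ P : 𝒜, Projective P → Injective P

/-- A Frobenius category: an abelian category with enough projectives and enough injectives in
which the projective objects and the injective objects coincide. -/
structure IsFrobeniusCategory : Prop where
  abelian : Nonempty (Abelian 𝒜)
  enoughProjectives : EnoughProjectives 𝒜
  enoughInjectives : EnoughInjectives 𝒜
  injective_of_projective : ∀ P : 𝒜, Projective P → Injective P
  projective_of_injective : ∀ I : 𝒜, Injective I → Projective I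

end Frobenius

/-- A local ring is Gorenstein if it is Noetherian and has finite injective dimension as a module
over itself. -/
def IsGorensteinLocalRing (R : Type u) [CommRing R] [IsLocalRing R] : Prop :=
  IsNoetherianRing R ∧ ∃ n : ℕ, HasInjectiveDimensionLE (ModuleCat.of R R) n

/-! A finitely presented functor is the cokernel of some Hom(-, a), so it is handled through one
generator `x` and one relation `a`. The stable category has biproducts and weak kernels (pullback
along a free cover), so these functors are closed under pointwise kernels and cokernels and form an
abelian category with the representables as enough projectives.

If R is artinian Gorenstein, then R is self-injective, finitely generated projectives are injective,
and every finitely generated module embeds in a free one. Pullbacks along free covers and pushouts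
along free embeddings then make every stable morphism a weak kernel, and a weak cokernel of its weak
kernel (`StableMod.hasFrobeniusWeakKernels`). The first property embeds every functor in a
representable one; the second makes representables injective (`ModCat.isFrobeniusCategory`).

Conversely, suppose representables are injective. If x in E has zero annihilator, then E → E/Rx is a
stable monomorphism, hence splits stably. Thus id - qp factors through a free module and fixes x; if
x is not in mE, some coordinate of the image of x is a unit, so x ↦ 1 under some E → R
(`StableMod.exists_dual_eq_one`). Suitable choices of E give a nonzero socle and then Baer's
criterion for R; a noetherian self-injective local ring is artinian. -/

set_option linter.unusedSectionVars false

/-! ### Functors given by a generator and a relation -/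

section Presentations

open CategoryTheory.Limits Opposite

variable {A : Type v} [Category.{u} A] [Preadditive A]

/-- The element `x` generates the functor `F`, and the relations on `x` are those induced by
the morphism `a`. In other words, `Hom(-, X₁) ⟶ Hom(-, X₀) ⟶ F ⟶ 0` is exact. -/
structure IsPresentedBy (F : Aᵒᵖ ⥤ AddCommGrpCat.{u}) {X₁ X₀ : A} (a : X₁ ⟶ X₀)
    (x : F.obj (op X₀)) : Prop where
  exists_map_eq : ∀ {Z : A} (t : F.obj (op Z)), ∃ f : Z ⟶ X₀, F.map f.op x = t
  map_eq_zero_iff : ∀ {Z : A} (f : Z ⟶ X₀), F.map f.op x = 0 ↔ ∃ g : Z ⟶ X₁, g ≫ a = f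

namespace FunctorElement

section

variable {A : Type v} [Category.{u} A] (F : Aᵒᵖ ⥤ AddCommGrpCat.{u})

theorem map_comp_apply {X Y Z : A} (f : X ⟶ Y) (g : Y ⟶ Z) (x : F.obj (op Z)) :
    F.map (f ≫ g).op x = F.map f.op (F.map g.op x) := by
  simp

theorem map_id_apply {X : A} (x : F.obj (op X)) : F.map (𝟙 X).op x = x := by
  simp

theorem app_map_apply {F G : Aᵒᵖ ⥤ AddCommGrpCat.{u}} (η : F ⟶ G) {X Y : A} (f : X ⟶ Y)
    (x : F.obj (op Y)) :
    η.app (op X) (F.map f.op x) = G.map f.op (η.app (op Y) x) :=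
  NatTrans.naturality_apply η f.op x

end

variable (F G : Aᵒᵖ ⥤ AddCommGrpCat.{u})

theorem map_add_apply [F.Additive] {X Y : A} (f g : X ⟶ Y) (x : F.obj (op Y)) :
    F.map (f + g).op x = F.map f.op x + F.map g.op x := by
  rw [op_add, F.map_add]; rfl

theorem map_sub_apply [F.Additive] {X Y : A} (f g : X ⟶ Y) (x : F.obj (op Y)) :
    F.map (f - g).op x = F.map f.op x - F.map g.op x := by
  rw [op_sub, F.map_sub]; rfl

theorem map_zero_apply [F.Additive] {X Y : A} (x : F.obj (op Y)) :
    F.map (0 : X ⟶ Y).op x = 0 := by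
  rw [op_zero, F.map_zero]; rfl

variable {F G}

theorem additive_of_map_add_apply
    (h : ∀ {X Y : A} (f g : X ⟶ Y) (x : F.obj (op Y)),
      F.map (f + g).op x = F.map f.op x + F.map g.op x) : F.Additive where
  map_add {X Y f g} := by
    ext x
    exact h f.unop g.unop x

theorem additive_of_injective [G.Additive] (η : F ⟶ G)
    (hη : ∀ Z, Function.Injective (η.app Z)) : F.Additive :=
  additive_of_map_add_apply fun f g x => hη _ (by
    rw [map_add, app_map_apply, app_map_apply, app_map_apply, map_add_apply])

theorem additive_of_surjective [F.Additive] (η : F ⟶ G)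
    (hη : ∀ Z, Function.Surjective (η.app Z)) : G.Additive :=
  additive_of_map_add_apply fun f g y => by
    obtain ⟨x, rfl⟩ := hη _ y
    rw [← app_map_apply, ← app_map_apply, ← app_map_apply, map_add_apply, map_add]

theorem preadditiveYoneda_map_id {X Z : A} (f : Z ⟶ X) :
    (preadditiveYoneda.obj X).map f.op (𝟙 X) = f :=
  Category.comp_id f

theorem preadditiveYoneda_app {X Z : A} (η : preadditiveYoneda.obj X ⟶ F) (f : Z ⟶ X) :
    η.app (op Z) f = F.map f.op (η.app (op X) (𝟙 X)) :=
  (congrArg _ (preadditiveYoneda_map_id f).symm).trans (app_map_apply η f (𝟙 X))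

end FunctorElement

open FunctorElement

theorem isPresentedBy_preadditiveYoneda (X : A) :
    IsPresentedBy (preadditiveYoneda.obj X) (0 : X ⟶ X) (𝟙 X) where
  exists_map_eq {Z} t := ⟨t, Category.comp_id (t : Z ⟶ X)⟩
  map_eq_zero_iff {Z} f := by
    refine (Eq.congr_left (preadditiveYoneda_map_id f)).trans ?_
    simp only [comp_zero, exists_const]
    exact eq_comm

namespace IsPresentedBy

variable {F G : Aᵒᵖ ⥤ AddCommGrpCat.{u}} {X₁ X₀ Y₁ Y₀ : A} {a : X₁ ⟶ X₀} {b : Y₁ ⟶ Y₀}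
  {x : F.obj (op X₀)} {y : G.obj (op Y₀)}

theorem map_relation (hF : IsPresentedBy F a x) : F.map a.op x = 0 :=
  (hF.map_eq_zero_iff a).2 ⟨𝟙 _, Category.id_comp a⟩

theorem map_eq_map [F.Additive] [G.Additive] (hF : IsPresentedBy F a x) {z : G.obj (op X₀)}
    (hz : G.map a.op z = 0) {Z : A} {f g : Z ⟶ X₀} (hfg : F.map f.op x = F.map g.op x) :
    G.map f.op z = G.map g.op z := by
  rw [← sub_eq_zero, ← map_sub_apply] at hfg ⊢
  obtain ⟨k, hk⟩ := (hF.map_eq_zero_iff _).1 hfg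
  rw [← hk, map_comp_apply, hz, map_zero]

/-- Universal property of the cokernel of Hom(-, a): write each element of F as a pullback of `x`
and pull back `z` instead. Independence of the choice is `map_eq_map`. -/
theorem exists_hom [F.Additive] [G.Additive] (hF : IsPresentedBy F a x) (z : G.obj (op X₀))
    (hz : G.map a.op z = 0) : ∃ η : F ⟶ G, η.app (op X₀) x = z := by
  choose c hc using fun (Z : A) (t : F.obj (op Z)) => hF.exists_map_eq t
  refine ⟨{ app := fun Z => AddCommGrpCat.ofHom
              { toFun := fun t => G.map (c Z.unop t).op z
                map_zero' := ?_
                map_add' := fun s t => ?_ }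
            naturality := fun Z W f => ?_ }, ?_⟩
  · rw [← map_zero_apply (X := Z.unop) G z]
    exact hF.map_eq_map hz (by rw [hc, map_zero_apply])
  · rw [← map_add_apply]
    exact hF.map_eq_map hz (by rw [map_add_apply, hc, hc, hc])
  · ext t
    change G.map (c W.unop (F.map f t)).op z = G.map f (G.map (c Z.unop t).op z)
    have := map_comp_apply G f.unop (c Z.unop t) z
    rw [Quiver.Hom.op_unop] at this
    rw [← this]
    refine hF.map_eq_map hz ?_
    rw [hc, map_comp_apply, hc, Quiver.Hom.op_unop]
  · change G.map (c X₀ x).op z = z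
    conv_rhs => rw [← map_id_apply G z]
    exact hF.map_eq_map hz (by rw [hc, map_id_apply])

theorem hom_ext (hF : IsPresentedBy F a x) {η θ : F ⟶ G}
    (h : η.app (op X₀) x = θ.app (op X₀) x) : η = θ := by
  ext Z t
  obtain ⟨f, rfl⟩ := hF.exists_map_eq (Z := Z.unop) t
  have h₁ := app_map_apply η f x
  have h₂ := app_map_apply θ f x
  rw [h, ← h₂] at h₁
  exact h₁

end IsPresentedBy

/-- The additive functors with values in abelian groups that are cokernels of morphisms between
representable functors. -/
def isPresented (A : Type v) [Category.{u} A] [Preadditive A] :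
    ObjectProperty (Aᵒᵖ ⥤ AddCommGrpCat.{u}) :=
  fun F => F.Additive ∧ ∃ (X₁ X₀ : A) (a : X₁ ⟶ X₀) (x : F.obj (op X₀)), IsPresentedBy F a x

theorem isFinitelyPresentedFunctor_iff (F : Aᵒᵖ ⥤+ AddCommGrpCat.{u}) :
    IsFinitelyPresentedFunctor A F ↔ isPresented A F.obj := by
  constructor
  · rintro ⟨X₁, X₀, φ, π, h⟩
    refine ⟨F.property, X₁, X₀, φ.app (op X₁) (𝟙 X₁), π.app (op X₀) (𝟙 X₀), ?_, ?_⟩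
    · intro Z t
      obtain ⟨f, rfl⟩ := (h (op Z)).2 t
      exact ⟨f, (preadditiveYoneda_app π f).symm⟩
    · intro Z f
      refine (Eq.congr_left (preadditiveYoneda_app π f).symm).trans (((h (op Z)).1 f).trans ?_)
      exact exists_congr fun g => Eq.congr_left (preadditiveYoneda_app φ g)
  · rintro ⟨_, X₁, X₀, a, x, h⟩
    obtain ⟨π, hπ⟩ := (isPresentedBy_preadditiveYoneda X₀).exists_hom x (map_zero_apply _ x)
    have key : ∀ {Z : A} (f : Z ⟶ X₀), π.app (op Z) f = F.obj.map f.op x := fun {Z} f =>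
      (preadditiveYoneda_app π f).trans (congrArg _ hπ)
    refine ⟨X₁, X₀, preadditiveYoneda.map a, π, fun Z => ⟨fun f => ?_, fun t => ?_⟩⟩
    · exact (Eq.congr_left (key (Z := Z.unop) f)).trans (h.map_eq_zero_iff (Z := Z.unop) f)
    · obtain ⟨f, hf⟩ := h.exists_map_eq (Z := Z.unop) t
      exact ⟨f, (key f).trans hf⟩

end Presentations

/-! ### Weak kernels and closure properties of presented functors -/

section Closure

open CategoryTheory.Limits Opposite
open FunctorElement

variable {A : Type v} [Category.{u} A] [Preadditive A]

/-- `k` is a weak kernel of `f`: the kernel condition without uniqueness. -/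
def IsWeakKernel {K X Y : A} (k : K ⟶ X) (f : X ⟶ Y) : Prop :=
  ∀ ⦃Z : A⦄ (h : Z ⟶ X), h ≫ f = 0 ↔ ∃ g : Z ⟶ K, g ≫ k = h

theorem IsWeakKernel.comp_eq_zero {K X Y : A} {k : K ⟶ X} {f : X ⟶ Y} (h : IsWeakKernel k f) :
    k ≫ f = 0 :=
  (h k).2 ⟨𝟙 K, Category.id_comp k⟩

variable (A) in
/-- Every morphism has a weak kernel. -/
class AdmitsWeakKernels : Prop where
  exists_isWeakKernel : ∀ {X Y : A} (f : X ⟶ Y), ∃ (K : A) (k : K ⟶ X), IsWeakKernel k f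

theorem exists_weakPullback [HasBinaryBiproducts A] [AdmitsWeakKernels A] {X Y Z : A}
    (f : X ⟶ Z) (g : Y ⟶ Z) :
    ∃ (W : A) (p : W ⟶ X) (q : W ⟶ Y), p ≫ f = q ≫ g ∧
      ∀ {T : A} (s : T ⟶ X) (t : T ⟶ Y), s ≫ f = t ≫ g → ∃ h : T ⟶ W, h ≫ p = s ∧ h ≫ q = t := by
  obtain ⟨W, w, hw⟩ := AdmitsWeakKernels.exists_isWeakKernel (biprod.desc f (-g))
  refine ⟨W, w ≫ biprod.fst, w ≫ biprod.snd, ?_, fun s t hst => ?_⟩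
  · have := hw.comp_eq_zero
    rw [biprod.desc_eq, Preadditive.comp_add] at this
    simpa [← sub_eq_add_neg, sub_eq_zero] using this
  · obtain ⟨h, hh⟩ := (hw (biprod.lift s t)).1 (by simp [hst])
    exact ⟨h, by simp [← Category.assoc, hh], by simp [← Category.assoc, hh]⟩

variable {F G : Aᵒᵖ ⥤ AddCommGrpCat.{u}}

theorem isPresented_of_kernel [HasBinaryBiproducts A] [AdmitsWeakKernels A]
    {K : Aᵒᵖ ⥤ AddCommGrpCat.{u}} (hF : isPresented A F) (hG : isPresented A G) (η : F ⟶ G)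
    (κ : K ⟶ F) (hκ : ∀ Z, Function.Injective (κ.app Z))
    (hex : ∀ Z, Function.Exact (κ.app Z) (η.app Z)) : isPresented A K := by
  obtain ⟨_, X₁, X₀, a, x, hx⟩ := hF
  obtain ⟨_, Y₁, Y₀, b, y, hy⟩ := hG
  obtain ⟨u, hu⟩ := hy.exists_map_eq (η.app _ x)
  -- Here `u` lifts `η` to generators. A pullback f^*x dies in G exactly when f ≫ u factors through
  -- `b`, so `W` generates the kernel; `V` then collects those maps to `W` that become relations of
  -- F.
  obtain ⟨W, p, q, hpq, hW⟩ := exists_weakPullback u b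
  obtain ⟨V, r, s, hrs, hV⟩ := exists_weakPullback p a
  obtain ⟨z, hz⟩ := (hex _ (F.map p.op x)).1 (by
    rw [app_map_apply, ← hu, ← map_comp_apply, hpq, map_comp_apply, hy.map_relation, map_zero])
  refine ⟨additive_of_injective κ hκ, V, W, r, z, fun {Z} t => ?_, fun {Z} f => ?_⟩
  · obtain ⟨f, hf⟩ := hx.exists_map_eq (κ.app _ t)
    have h₀ : η.app _ (κ.app _ t) = 0 := (hex _ _).2 ⟨t, rfl⟩
    rw [← hf, app_map_apply, ← hu, ← map_comp_apply, hy.map_eq_zero_iff] at h₀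
    obtain ⟨g, hg⟩ := h₀
    obtain ⟨h, rfl, -⟩ := hW f g hg.symm
    exact ⟨h, hκ _ (by rw [app_map_apply, hz, ← map_comp_apply, hf])⟩
  · rw [← (hκ _).eq_iff, app_map_apply, hz, map_zero, ← map_comp_apply, hx.map_eq_zero_iff]
    constructor
    · rintro ⟨g, hg⟩
      obtain ⟨h, hh, -⟩ := hV f g hg.symm
      exact ⟨h, hh⟩
    · rintro ⟨g, rfl⟩
      exact ⟨g ≫ s, by simp [hrs]⟩

/-- An element f^*y lies in the image of `η` when f is, modulo `b`, a multiple of the lift `u` of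
`η`. So `c` = (b, u) presents the cokernel of `η`, and its image describes the subfunctor im `η` of
G. -/
theorem IsPresentedBy.exists_presentation_of_exact [HasBinaryBiproducts A] [F.Additive]
    [G.Additive] {X₁ X₀ Y₁ Y₀ : A} {a : X₁ ⟶ X₀} {x : F.obj (op X₀)} {b : Y₁ ⟶ Y₀}
    {y : G.obj (op Y₀)} (hx : IsPresentedBy F a x) (hy : IsPresentedBy G b y) (η : F ⟶ G) :
    ∃ (S : A) (c : S ⟶ Y₀), ∀ {Z : A} (f : Z ⟶ Y₀),
      (∃ t, η.app (op Z) t = G.map f.op y) ↔ ∃ g : Z ⟶ S, g ≫ c = f := by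
  obtain ⟨u, hu⟩ := hy.exists_map_eq (η.app _ x)
  refine ⟨Y₁ ⊞ X₀, biprod.desc b u, fun {Z} f => ⟨?_, ?_⟩⟩
  · rintro ⟨t, ht⟩
    obtain ⟨g, rfl⟩ := hx.exists_map_eq t
    rw [app_map_apply, ← hu, ← map_comp_apply, eq_comm, ← sub_eq_zero, ← map_sub_apply,
      hy.map_eq_zero_iff] at ht
    obtain ⟨h, hh⟩ := ht
    exact ⟨biprod.lift h g, by simp [hh]⟩
  · rintro ⟨g, rfl⟩
    refine ⟨F.map (g ≫ biprod.snd).op x, ?_⟩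
    rw [app_map_apply, ← hu, ← map_comp_apply, biprod.desc_eq, Preadditive.comp_add,
      map_add_apply, ← Category.assoc, ← Category.assoc, map_comp_apply G (g ≫ biprod.fst),
      hy.map_relation, map_zero, zero_add]

theorem isPresented_of_cokernel [HasBinaryBiproducts A]
    {Q : Aᵒᵖ ⥤ AddCommGrpCat.{u}} (hF : isPresented A F) (hG : isPresented A G) (η : F ⟶ G)
    (π : G ⟶ Q) (hπ : ∀ Z, Function.Surjective (π.app Z))
    (hex : ∀ Z, Function.Exact (η.app Z) (π.app Z)) : isPresented A Q := by
  obtain ⟨_, X₁, X₀, a, x, hx⟩ := hF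
  obtain ⟨_, Y₁, Y₀, b, y, hy⟩ := hG
  obtain ⟨S, c, hc⟩ := hx.exists_presentation_of_exact hy η
  refine ⟨additive_of_surjective π hπ, S, Y₀, c, π.app _ y, fun {Z} t => ?_, fun {Z} f => ?_⟩
  · obtain ⟨s, rfl⟩ := hπ _ t
    obtain ⟨f, rfl⟩ := hy.exists_map_eq s
    exact ⟨f, (app_map_apply π f y).symm⟩
  · rw [← app_map_apply, ← hc]
    exact hex _ _

theorem isPresented_preadditiveYoneda (X : A) : isPresented A (preadditiveYoneda.obj X) :=
  ⟨inferInstance, X, X, 0, 𝟙 X, isPresentedBy_preadditiveYoneda X⟩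

theorem isPresented_of_isBilimit [HasBinaryBiproducts A] (hF : isPresented A F)
    (hG : isPresented A G) {B : BinaryBicone F G} (hB : B.IsBilimit) :
    isPresented A B.pt := by
  obtain ⟨_, X₁, X₀, a, x, hx⟩ := hF
  obtain ⟨_, Y₁, Y₀, b, y, hy⟩ := hG
  have hip' : ∀ {Z : A} (t : F.obj (op Z)), B.fst.app _ (B.inl.app _ t) = t := fun t =>
    congrArg (fun e : F ⟶ F => e.app _ t) B.inl_fst
  have hiq' : ∀ {Z : A} (t : F.obj (op Z)), B.snd.app _ (B.inl.app _ t) = 0 := fun t =>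
    congrArg (fun e : F ⟶ G => e.app _ t) B.inl_snd
  have hjp' : ∀ {Z : A} (t : G.obj (op Z)), B.fst.app _ (B.inr.app _ t) = 0 := fun t =>
    congrArg (fun e : G ⟶ F => e.app _ t) B.inr_fst
  have hjq' : ∀ {Z : A} (t : G.obj (op Z)), B.snd.app _ (B.inr.app _ t) = t := fun t =>
    congrArg (fun e : G ⟶ G => e.app _ t) B.inr_snd
  have total' : ∀ {Z : A} (t : B.pt.obj (op Z)), B.inl.app _ (B.fst.app _ t) + B.inr.app _ (B.snd.app _ t) = t :=
    fun t => congrArg (fun e : B.pt ⟶ B.pt => e.app _ t) (IsBilimit.binary_total hB)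
  have ext : ∀ {Z : A} {s t : B.pt.obj (op Z)}, B.fst.app _ s = B.fst.app _ t → B.snd.app _ s = B.snd.app _ t →
      s = t := fun {Z s t} h₁ h₂ => by
    rw [← total' s, h₁, h₂, total']
  have hp : ∀ {Z : A} (f : Z ⟶ X₀ ⊞ Y₀), B.fst.app _ (B.pt.map f.op
      (B.inl.app _ (F.map biprod.fst.op x) + B.inr.app _ (G.map biprod.snd.op y))) =
        F.map (f ≫ biprod.fst).op x := fun f => by
    rw [app_map_apply, map_add, hip', hjp', add_zero, map_comp_apply]
  have hq : ∀ {Z : A} (f : Z ⟶ X₀ ⊞ Y₀), B.snd.app _ (B.pt.map f.op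
      (B.inl.app _ (F.map biprod.fst.op x) + B.inr.app _ (G.map biprod.snd.op y))) =
        G.map (f ≫ biprod.snd).op y := fun f => by
    rw [app_map_apply, map_add, hiq', hjq', zero_add, map_comp_apply]
  refine ⟨additive_of_map_add_apply fun f g t => ext ?_ ?_, X₁ ⊞ Y₁, X₀ ⊞ Y₀, biprod.map a b,
    B.inl.app _ (F.map biprod.fst.op x) + B.inr.app _ (G.map biprod.snd.op y),
    fun {Z} t => ?_, fun {Z} f => ?_⟩
  · simp only [map_add, app_map_apply, map_add_apply]
  · simp only [map_add, app_map_apply, map_add_apply]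
  · obtain ⟨f, hf⟩ := hx.exists_map_eq (B.fst.app _ t)
    obtain ⟨g, hg⟩ := hy.exists_map_eq (B.snd.app _ t)
    exact ⟨biprod.lift f g, ext (by rw [hp, biprod.lift_fst, hf]) (by rw [hq, biprod.lift_snd, hg])⟩
  · have : B.pt.map f.op (B.inl.app _ (F.map biprod.fst.op x) + B.inr.app _ (G.map biprod.snd.op y)) = 0 ↔
        F.map (f ≫ biprod.fst).op x = 0 ∧ G.map (f ≫ biprod.snd).op y = 0 := by
      rw [← hp, ← hq]
      exact ⟨fun h => by rw [h, map_zero, map_zero]; exact ⟨rfl, rfl⟩,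
        fun h => ext (by rw [h.1, map_zero]) (by rw [h.2, map_zero])⟩
    rw [this, hx.map_eq_zero_iff, hy.map_eq_zero_iff]
    constructor
    · rintro ⟨⟨g, hg⟩, h, hh⟩
      exact ⟨biprod.lift g h, by ext <;> simp [hg, hh]⟩
    · rintro ⟨g, rfl⟩
      exact ⟨⟨g ≫ biprod.fst, by simp⟩, g ≫ biprod.snd, by simp⟩

end Closure

/-! ### The abelian structure on finitely presented functors -/

section Abelian

open CategoryTheory.Limits Opposite
open FunctorElement

variable (A : Type v) [Category.{u} A] [Preadditive A]

instance [HasZeroObject A] : (isPresented A).ContainsZero where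
  exists_zero := by
    obtain ⟨Z, hZ⟩ := HasZeroObject.zero (C := A)
    refine ⟨preadditiveYoneda.obj Z, ?_, isPresented_preadditiveYoneda _⟩
    rw [IsZero.iff_id_eq_zero]
    exact (isPresentedBy_preadditiveYoneda Z).hom_ext (hZ.eq_of_tgt (𝟙 Z) 0)

instance [HasBinaryBiproducts A] [AdmitsWeakKernels A] : (isPresented A).IsClosedUnderKernels where
  kernels_le := by
    rintro _ ⟨f, k, hk, hF, hG⟩
    have hex : (ShortComplex.mk k.ι f k.condition).Exact := ShortComplex.exact_of_f_is_kernel _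
      (IsLimit.ofIsoLimit hk (Fork.ext (Iso.refl _)))
    have : Mono k.ι := Fork.IsLimit.mono hk
    refine isPresented_of_kernel hF hG f k.ι (fun Z => ?_) (fun Z => ?_)
    · rw [← AddCommGrpCat.mono_iff_injective]
      infer_instance
    · exact (ShortComplex.ab_exact_iff_function_exact _).1 (hex.map ((evaluation _ _).obj Z))

instance [HasBinaryBiproducts A] : (isPresented A).IsClosedUnderCokernels where
  cokernels_le := by
    rintro _ ⟨f, k, hk, hF, hG⟩
    have hex : (ShortComplex.mk f k.π k.condition).Exact := ShortComplex.exact_of_g_is_cokernel _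
      (IsColimit.ofIsoColimit hk (Cofork.ext (Iso.refl _)))
    have : Epi k.π := Cofork.IsColimit.epi hk
    refine isPresented_of_cokernel hF hG f k.π (fun Z => ?_) (fun Z => ?_)
    · rw [← AddCommGrpCat.epi_iff_surjective]
      infer_instance
    · exact (ShortComplex.ab_exact_iff_function_exact _).1 (hex.map ((evaluation _ _).obj Z))

instance [HasBinaryBiproducts A] : (isPresented A).IsClosedUnderBinaryProducts where
  limitsOfShape_le := by
    rintro P ⟨h⟩
    exact isPresented_of_isBilimit (h.prop_diag_obj ⟨.left⟩) (h.prop_diag_obj ⟨.right⟩)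
      (binaryBiconeIsBilimitOfLimitConeOfIsLimit
        ((IsLimit.postcomposeHomEquiv (diagramIsoPair h.diag) _).2 h.isLimit))

instance [HasBinaryBiproducts A] : (isPresented A).IsClosedUnderIsomorphisms where
  of_iso {F G} e hF := by
    have he : ∀ Z, Function.Bijective (e.hom.app Z) := fun Z =>
      ConcreteCategory.bijective_of_isIso (e.hom.app Z)
    -- An isomorphism is a cokernel of the zero map.
    refine isPresented_of_cokernel hF hF 0 e.hom (fun Z => (he Z).2) fun Z t => ?_
    rw [← map_zero (e.hom.app Z).hom]
    exact ((he Z).1.eq_iff (b := 0)).trans ⟨fun h => ⟨0, h.symm⟩, fun ⟨_, h⟩ => h.symm⟩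

instance [HasBinaryBiproducts A] [HasZeroObject A] [AdmitsWeakKernels A] :
    (isPresented A).IsClosedUnderFiniteProducts :=
  ObjectProperty.IsClosedUnderFiniteProducts.mk'

/-- The finitely presented functors, as a full subcategory of the category of all functors. -/
abbrev PresentedFunctor := (isPresented A).FullSubcategory

namespace ModCat

/-- Forgetting that the functor is additive. -/
abbrev toPresented : ModCat A ⥤ PresentedFunctor A :=
  ObjectProperty.lift _ ((IsFinitelyPresentedFunctor A).ι ⋙ AdditiveFunctor.forget _ _)
    fun F => (isFinitelyPresentedFunctor_iff F.obj).1 F.property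

variable {A} in
/-- A finitely presented functor as an object of `ModCat A`. -/
abbrev ofPresented (F : Aᵒᵖ ⥤ AddCommGrpCat.{u}) (hF : isPresented A F) : ModCat A :=
  ⟨⟨F, hF.1⟩, (isFinitelyPresentedFunctor_iff _).2 hF⟩

variable {A} in
/-- Morphisms in `ModCat A` are natural transformations. -/
abbrev homMk {F G : ModCat A} (η : F.obj.obj ⟶ G.obj.obj) : F ⟶ G :=
  ObjectProperty.homMk (ObjectProperty.homMk η)

instance : (toPresented A).Full where
  map_surjective f := ⟨homMk f.hom, rfl⟩

instance : (toPresented A).Faithful where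
  map_injective {F G f g} h := by
    ext : 2
    exact congrArg (fun e => e.hom) h

instance : (toPresented A).EssSurj where
  mem_essImage F := ⟨ofPresented F.obj F.property, ⟨Iso.refl _⟩⟩

instance : (toPresented A).IsEquivalence where

instance : (toPresented A).Additive where

instance [HasBinaryBiproducts A] [HasZeroObject A] [AdmitsWeakKernels A] :
    HasFiniteProducts (ModCat A) :=
  have : (toPresented A).asEquivalence.functor.Additive :=
    inferInstanceAs (toPresented A).Additive
  (toPresented A).asEquivalence.inverse.hasFiniteProducts_of_additive_of_essSurj

theorem nonempty_abelian [HasBinaryBiproducts A] [HasZeroObject A] [AdmitsWeakKernels A] :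
    Nonempty (Abelian (ModCat A)) :=
  ⟨abelianOfEquivalence (toPresented A)⟩

variable {A}

theorem isPresented (F : ModCat A) : isPresented A F.obj.obj :=
  (isFinitelyPresentedFunctor_iff F.obj).1 F.property

theorem mono_of_injective {F G : ModCat A} (f : F ⟶ G)
    (hf : ∀ Z, Function.Injective (f.hom.hom.app Z)) : Mono f := by
  have : Mono f.hom.hom := by
    rw [NatTrans.mono_iff_mono_app]
    exact fun Z => (AddCommGrpCat.mono_iff_injective _).2 (hf Z)
  exact (((toPresented A) ⋙ (CategoryTheory.ObjectProperty.ι _))).mono_of_mono_map this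

/-- Kernels are computed pointwise, so the inclusion into all functors preserves monomorphisms. -/
theorem injective_of_mono [HasBinaryBiproducts A] [HasZeroObject A] [AdmitsWeakKernels A]
    {F G : ModCat A} (f : F ⟶ G) [Mono f] (Z : Aᵒᵖ) :
    Function.Injective (f.hom.hom.app Z) := by
  have := (_root_.isPresented A).preservesMonomorphisms_ι_of_isNormalEpiCategory
  have : Mono f.hom.hom :=
    inferInstanceAs (Mono ((_root_.isPresented A).ι.map ((toPresented A).map f)))
  rw [← AddCommGrpCat.mono_iff_injective]
  infer_instance

theorem epi_of_surjective {F G : ModCat A} (f : F ⟶ G)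
    (hf : ∀ Z, Function.Surjective (f.hom.hom.app Z)) : Epi f := by
  have : Epi f.hom.hom := by
    rw [NatTrans.epi_iff_epi_app]
    exact fun Z => (AddCommGrpCat.epi_iff_surjective _).2 (hf Z)
  exact (((toPresented A) ⋙ (CategoryTheory.ObjectProperty.ι _))).epi_of_epi_map this

theorem surjective_of_epi [HasBinaryBiproducts A] [HasZeroObject A]
    {F G : ModCat A} (f : F ⟶ G) [Epi f] (Z : Aᵒᵖ) :
    Function.Surjective (f.hom.hom.app Z) := by
  have := (_root_.isPresented A).preservesEpimorphisms_ι_of_isNormalMonoCategory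
  have : Epi f.hom.hom :=
    inferInstanceAs (Epi ((_root_.isPresented A).ι.map ((toPresented A).map f)))
  rw [← AddCommGrpCat.epi_iff_surjective]
  infer_instance

end ModCat

end Abelian

/-! ### From weak kernels to the Frobenius property -/

section Frobenius

open CategoryTheory.Limits Opposite
open FunctorElement

variable {A : Type v} [Category.{u} A] [Preadditive A]

/-- Every morphism `b` is a weak cokernel of a weak kernel of itself, and a weak kernel. -/
def HasFrobeniusWeakKernels (A : Type v) [Category.{u} A] [Preadditive A] : Prop :=
  ∀ ⦃B C : A⦄ (b : B ⟶ C),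
    (∃ (K : A) (a : K ⟶ B), IsWeakKernel a b ∧
      ∀ ⦃X : A⦄ (f : B ⟶ X), a ≫ f = 0 → ∃ g : C ⟶ X, b ≫ g = f) ∧
    ∃ (D : A) (d : C ⟶ D), IsWeakKernel b d

namespace ModCat

/-- The representable functors. -/
abbrev yoneda (X : A) : ModCat A :=
  ofPresented (preadditiveYoneda.obj X) (isPresented_preadditiveYoneda X)

theorem exists_epi_yoneda (F : ModCat A) : ∃ (X : A) (π : yoneda X ⟶ F), Epi π := by
  obtain ⟨_, X₁, X₀, a, x, hx⟩ := F.isPresented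
  obtain ⟨π, hπ⟩ := (isPresentedBy_preadditiveYoneda X₀).exists_hom x (map_zero_apply _ x)
  refine ⟨X₀, homMk π, epi_of_surjective _ fun Z t => ?_⟩
  obtain ⟨f, rfl⟩ := hx.exists_map_eq (Z := Z.unop) t
  exact ⟨f, (preadditiveYoneda_app π f).trans (congrArg _ hπ)⟩

variable [HasBinaryBiproducts A] [HasZeroObject A]

instance projective_yoneda (X : A) : Projective (yoneda X) where
  factors {F G} f e _ := by
    have := F.obj.property
    have := G.obj.property
    obtain ⟨t, ht⟩ := surjective_of_epi e (op X) (f.hom.hom.app (op X) (𝟙 X))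
    obtain ⟨η, hη⟩ := (isPresentedBy_preadditiveYoneda X).exists_hom t (map_zero_apply _ t)
    refine ⟨homMk η, ?_⟩
    ext : 2
    refine (isPresentedBy_preadditiveYoneda X).hom_ext ?_
    exact (congrArg _ hη).trans ht

instance : EnoughProjectives (ModCat A) where
  presentation F := by
    obtain ⟨X, π, _⟩ := exists_epi_yoneda F
    exact ⟨⟨yoneda X, π⟩⟩

theorem injective_of_projective_of_yoneda (h : ∀ X : A, Injective (yoneda X)) (P : ModCat A)
    [Projective P] : Injective P := by
  obtain ⟨X, π, _⟩ := exists_epi_yoneda P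
  have := h X
  exact (Retract.mk _ π (Projective.factorThru_comp (𝟙 P) π)).injective

/-- Let `c` describe the subfunctor F of G and let `r` in F(S) be the element mapping to c^*y. The
weak kernel of `c` kills `r`, hence kills f(r), so f(r) factors as c ≫ s. Sending `y` to `s` extends
`f` to G. -/
theorem injective_yoneda [AdmitsWeakKernels A] (hA : HasFrobeniusWeakKernels A) (X : A) :
    Injective (yoneda X) where
  factors {F G} f i _ := by
    have hi := injective_of_mono i
    obtain ⟨_, X₁, X₀, a, x, hx⟩ := F.isPresented
    obtain ⟨_, Y₁, Y₀, b, y, hy⟩ := G.isPresented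
    obtain ⟨S, c, hc⟩ := hx.exists_presentation_of_exact hy i.hom.hom
    obtain ⟨r, hr⟩ := (hc c).2 ⟨𝟙 S, Category.id_comp c⟩
    obtain ⟨⟨K, k, hk, hfac⟩, -⟩ := hA c
    have hgen : ∀ {Z : A} (g : Z ⟶ S) , i.hom.hom.app _ (F.obj.obj.map g.op r) =
        G.obj.obj.map (g ≫ c).op y := fun g => by
      rw [app_map_apply, hr, map_comp_apply]
    have hkr : F.obj.obj.map k.op r = 0 := hi _ (by
      rw [hgen, hk.comp_eq_zero, map_zero_apply, map_zero])
    obtain ⟨s, hs⟩ := hfac (X := X) (f.hom.hom.app _ r) (by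
      have := app_map_apply f.hom.hom k r
      rw [hkr, map_zero] at this
      exact this.symm)
    have hs' : ∀ {Z : A} (g : Z ⟶ S), (preadditiveYoneda.obj X).map (g ≫ c).op s =
        f.hom.hom.app _ (F.obj.obj.map g.op r) := fun g => 
      (map_comp_apply (preadditiveYoneda.obj X) g c s).trans
        ((congrArg _ hs).trans (app_map_apply f.hom.hom g r).symm)
    have hfactor : ∀ {Z : A} (t : F.obj.obj.obj (op Z)), ∃ g : Z ⟶ S, F.obj.obj.map g.op r = t := by
      intro Z t
      obtain ⟨h, hh⟩ := hy.exists_map_eq (i.hom.hom.app _ t)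
      obtain ⟨g, rfl⟩ := (hc h).1 ⟨t, hh.symm⟩
      exact ⟨g, hi _ (by rw [hgen, hh])⟩
    -- The relation `b` factors through `c`, because b^*y = 0 comes from F.
    obtain ⟨η, hη⟩ := hy.exists_hom (G := preadditiveYoneda.obj X) s (by
      obtain ⟨g, rfl⟩ := (hc b).1 ⟨0, by rw [map_zero, hy.map_relation]⟩
      have : F.obj.obj.map g.op r = 0 := hi _ (by rw [hgen, hy.map_relation, map_zero])
      rw [hs', this, map_zero])
    refine ⟨homMk η, ?_⟩
    ext : 2
    refine hx.hom_ext ?_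
    obtain ⟨g, hg⟩ := hfactor x
    change η.app _ (i.hom.hom.app _ x) = f.hom.hom.app _ x
    rw [← hg, hgen, app_map_apply, hη, hs']

/-- If `a` is a weak kernel of `d`, the cokernel of Hom(-, a) is the image of Hom(-, d), a
subfunctor of Hom(-, D). -/
theorem exists_mono_yoneda (hA : HasFrobeniusWeakKernels A) (F : ModCat A) :
    ∃ (X : A) (ι : F ⟶ yoneda X), Mono ι := by
  obtain ⟨_, X₁, X₀, a, x, hx⟩ := F.isPresented
  obtain ⟨-, D, d, hd⟩ := hA a
  obtain ⟨ι, hι⟩ := hx.exists_hom (G := preadditiveYoneda.obj D) d hd.comp_eq_zero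
  refine ⟨D, homMk ι, mono_of_injective _ fun Z => ?_⟩
  refine (injective_iff_map_eq_zero (ι.app Z).hom).2 fun t ht => ?_
  obtain ⟨f, rfl⟩ := hx.exists_map_eq (Z := Z.unop) t
  refine (hx.map_eq_zero_iff (Z := Z.unop) f).2 ((hd f).1 ?_)
  have := app_map_apply ι f x
  rw [hι] at this
  exact this.symm.trans ht

theorem isFrobeniusCategory [AdmitsWeakKernels A] (hA : HasFrobeniusWeakKernels A) :
    IsFrobeniusCategory (ModCat A) where
  abelian := nonempty_abelian A
  enoughProjectives := inferInstance
  enoughInjectives :=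
    { presentation := fun F => by
        obtain ⟨X, ι, _⟩ := exists_mono_yoneda hA F
        have := injective_yoneda hA X
        exact ⟨⟨yoneda X, this, ι, inferInstance⟩⟩ }
  injective_of_projective P _ := injective_of_projective_of_yoneda (injective_yoneda hA) P
  projective_of_injective I _ := by
    obtain ⟨X, ι, _⟩ := exists_mono_yoneda hA I
    exact (Retract.mk ι _ (Injective.comp_factorThru (𝟙 I) ι)).projective

/-- If `Hom(-, X)` is an injective object, then a morphism out of `X` inducing a monomorphism of
representable functors is a split monomorphism. -/
theorem exists_retraction {X Y : A} [Injective (yoneda X)] (p : X ⟶ Y)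
    (hp : ∀ ⦃Z : A⦄ (f : Z ⟶ X), f ≫ p = 0 → f = 0) : ∃ h : Y ⟶ X, p ≫ h = 𝟙 X := by
  let P : yoneda X ⟶ yoneda Y := homMk (preadditiveYoneda.map p)
  have : Mono P := mono_of_injective _ fun Z =>
    (injective_iff_map_eq_zero ((preadditiveYoneda.map p).app Z).hom).2 fun f hf => hp f hf
  obtain ⟨h, hh⟩ := preadditiveYoneda.map_surjective (Injective.factorThru (𝟙 (yoneda X)) P).hom.hom
  refine ⟨h, preadditiveYoneda.map_injective ?_⟩
  rw [CategoryTheory.Functor.map_comp, hh, CategoryTheory.Functor.map_id]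
  exact congrArg (fun e => e.hom.hom) (Injective.comp_factorThru (𝟙 (yoneda X)) P)

end ModCat

end Frobenius

/-! ### Weak kernels and weak cokernels in the stable category -/

section StableMod

open CategoryTheory.Limits Opposite

variable {R : Type u} [CommRing R]

namespace StableMod

variable (R) in
/-- A finitely generated module as an object of the stable category. -/
abbrev of (M : Type u) [AddCommGroup M] [Module R M] [Module.Finite R M] : StableMod R :=
  ⟨FGModuleCat.of R M⟩

variable {M N L : Type u} [AddCommGroup M] [Module R M] [Module.Finite R M]
  [AddCommGroup N] [Module R N] [Module.Finite R N]
  [AddCommGroup L] [Module R L] [Module.Finite R L]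

/-- The class of a linear map in the stable category. -/
def ofHom (f : M →ₗ[R] N) : of R M ⟶ of R N :=
  (Quotient.functor (stableRel R)).map (FGModuleCat.ofHom f)

@[elab_as_elim]
theorem induction_on {motive : StableMod R → Prop} (X : StableMod R)
    (h : ∀ (M : Type u) [AddCommGroup M] [Module R M] [Module.Finite R M], motive (of R M)) :
    motive X :=
  h X.as

theorem ofHom_surjective : Function.Surjective (ofHom : (M →ₗ[R] N) → (of R M ⟶ of R N)) := by
  intro f
  obtain ⟨g, rfl⟩ := (Quotient.functor (stableRel R)).map_surjective f
  exact ⟨g.hom.hom, rfl⟩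

theorem ofHom_comp (f : M →ₗ[R] N) (g : N →ₗ[R] L) : ofHom (g ∘ₗ f) = ofHom f ≫ ofHom g :=
  rfl

theorem ofHom_id : ofHom (LinearMap.id : M →ₗ[R] M) = 𝟙 _ :=
  rfl

theorem ofHom_eq_iff (f g : M →ₗ[R] N) : ofHom f = ofHom g ↔
    FactorsThroughProjective R (FGModuleCat.ofHom (f - g)) :=
  Quotient.functor_map_eq_iff _ _ _

theorem ofHom_zero : ofHom (0 : M →ₗ[R] N) = 0 :=
  rfl

instance : (Quotient.functor (stableRel R)).Additive :=
  Quotient.functor_additive (stableRel R) _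

theorem ofHom_sub (f g : M →ₗ[R] N) : ofHom (f - g) = ofHom f - ofHom g :=
  (Quotient.functor (stableRel R)).map_sub (f := FGModuleCat.ofHom f) (g := FGModuleCat.ofHom g)

theorem ofHom_eq_zero_iff (f : M →ₗ[R] N) : ofHom f = 0 ↔
    ∃ (P : FGModuleCat.{u} R) (_ : Module.Projective R P) (a : M →ₗ[R] P) (b : P →ₗ[R] N),
      b ∘ₗ a = f := by
  rw [← ofHom_zero, ofHom_eq_iff, sub_zero]
  constructor
  · rintro ⟨P, hP, a, b, h⟩
    exact ⟨P, hP, a.hom.hom, b.hom.hom, congrArg (fun e => e.hom.hom) h⟩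
  · rintro ⟨P, hP, a, b, rfl⟩
    exact ⟨P, hP, FGModuleCat.ofHom a, FGModuleCat.ofHom b, rfl⟩

theorem ofHom_comp_eq_zero (P : Type u) [AddCommGroup P] [Module R P] [Module.Finite R P]
    [hP : Module.Projective R P] (a : M →ₗ[R] P) (b : P →ₗ[R] N) : ofHom (b ∘ₗ a) = 0 :=
  (ofHom_eq_zero_iff _).2 ⟨FGModuleCat.of R P, hP, a, b, rfl⟩

theorem exists_lift_of_ofHom_eq_zero {f : M →ₗ[R] N} (hf : ofHom f = 0) (π : L →ₗ[R] N)
    (hπ : Function.Surjective π) :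
    ∃ (P : FGModuleCat.{u} R) (_ : Module.Projective R P) (a : M →ₗ[R] P) (b : P →ₗ[R] L),
      π ∘ₗ b ∘ₗ a = f := by
  obtain ⟨P, hP, a, b, rfl⟩ := (ofHom_eq_zero_iff f).1 hf
  obtain ⟨c, rfl⟩ := Module.projective_lifting_property π b hπ
  exact ⟨P, hP, a, c, rfl⟩

variable [IsNoetherianRing R]

instance : HasFiniteProducts (StableMod R) :=
  (Quotient.functor (stableRel R)).hasFiniteProducts_of_additive_of_essSurj

instance : HasFiniteBiproducts (StableMod R) := .of_hasFiniteProducts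

instance : HasBinaryBiproducts (StableMod R) := hasBinaryBiproducts_of_finite_biproducts _

section

variable (b : M →ₗ[R] N) (π : L →ₗ[R] N)

/-- The projection from the pullback of `b` and `π` to the source of `b`. -/
abbrev pullbackFst : LinearMap.ker (b.coprod π) →ₗ[R] M :=
  LinearMap.fst R M L ∘ₗ (LinearMap.ker (b.coprod π)).subtype

theorem isWeakKernel_pullbackFst [Module.Projective R L] (hπ : Function.Surjective π) :
    IsWeakKernel (ofHom (pullbackFst b π)) (ofHom b) := by
  intro Z h
  induction Z using induction_on with | _ Z => ?_
  obtain ⟨h, rfl⟩ := ofHom_surjective h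
  constructor
  · intro hb
    obtain ⟨P, _, s, t, hst⟩ := exists_lift_of_ofHom_eq_zero (f := b ∘ₗ h) hb π hπ
    -- The pullback is realised as the kernel of b + π, hence the sign.
    refine ⟨ofHom ((h.prod (-(t ∘ₗ s))).codRestrict _ fun z => ?_), rfl⟩
    have := LinearMap.congr_fun hst z
    simp at this ⊢
    rw [this, add_neg_cancel]
  · rintro ⟨g, hg⟩
    rw [← hg, Category.assoc, ← ofHom_comp]
    have : b ∘ₗ pullbackFst b π =
        (-π) ∘ₗ (LinearMap.snd R M L ∘ₗ (LinearMap.ker (b.coprod π)).subtype) := by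
      ext ⟨x, hx⟩
      simpa [add_eq_zero_iff_eq_neg] using hx
    rw [this, ofHom_comp_eq_zero, comp_zero]

/-- On the pullback, f ∘ fst factors through a projective P. As P is injective, this factorization
extends to M × L; subtracting it from f ∘ fst gives a map that descends along the surjection M × L →
N. -/
theorem exists_factorization_of_pullbackFst_comp [Module.Projective R L] 
    (hπ : Function.Surjective π)
    (hinj : ∀ (P : FGModuleCat.{u} R), Module.Projective R P → Module.Injective R P)
    {X : StableMod R} (f : of R M ⟶ X) (hf : ofHom (pullbackFst b π) ≫ f = 0) :
    ∃ g : of R N ⟶ X, ofHom b ≫ g = f := by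
  induction X using induction_on with | _ X => ?_
  obtain ⟨f, rfl⟩ := ofHom_surjective f
  obtain ⟨P, hP, s, t, hst⟩ := (ofHom_eq_zero_iff (f ∘ₗ pullbackFst b π)).1 hf
  obtain ⟨e, he⟩ := (hinj P hP).out (LinearMap.ker (b.coprod π)).subtype
    (Submodule.injective_subtype _) s
  have hsurj : Function.Surjective (b.coprod π) := fun y => by
    obtain ⟨x, rfl⟩ := hπ y
    exact ⟨(0, x), by simp⟩
  have hker : LinearMap.ker (b.coprod π) ≤
      LinearMap.ker (f ∘ₗ LinearMap.fst R M L - t ∘ₗ e) := fun x hx => by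
    have h₁ := LinearMap.congr_fun hst ⟨x, hx⟩
    have h₂ := he ⟨x, hx⟩
    simp at h₁ h₂ ⊢
    rw [h₂, h₁, sub_self]
  let g : N →ₗ[R] X := (LinearMap.ker (b.coprod π)).liftQ _ hker ∘ₗ
    ((b.coprod π).quotKerEquivOfSurjective hsurj).symm.toLinearMap
  have hg : ∀ z : M × L, g (b.coprod π z) = f z.1 - t (e z) := fun z => by
    have : ((b.coprod π).quotKerEquivOfSurjective hsurj).symm (b.coprod π z) =
        Submodule.Quotient.mk z := by
      rw [LinearEquiv.symm_apply_eq]; rfl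
    simp only [g, LinearMap.comp_apply, LinearEquiv.coe_coe, this]
    rfl
  refine ⟨ofHom g, ?_⟩
  have : g ∘ₗ b = f - t ∘ₗ (e ∘ₗ LinearMap.inl R M L) := by
    ext x
    simpa using hg (x, 0)
  rw [← ofHom_comp, this, ofHom_sub, ofHom_comp_eq_zero, sub_zero]

end

section

variable (b : M →ₗ[R] N) (j : M →ₗ[R] L)

/-- The map from the target of `b` to the pushout of `b` and `j`. -/
abbrev pushoutInl : N →ₗ[R] (N × L) ⧸ LinearMap.range (b.prod j) :=
  (LinearMap.range (b.prod j)).mkQ ∘ₗ LinearMap.inl R N L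

/-- If N → pushout kills h stably, lift the factorization through a projective to N × L. The
corrected map (h, 0) - ts lands in the image of (b, j), a copy of M because `j` is injective. -/
theorem isWeakKernel_pushoutInl [Module.Projective R L] (hj : Function.Injective j) :
    IsWeakKernel (ofHom b) (ofHom (pushoutInl b j)) := by
  intro Z h
  induction Z using induction_on with | _ Z => ?_
  obtain ⟨h, rfl⟩ := ofHom_surjective h
  constructor
  · intro hb
    obtain ⟨P, _, s, t, hst⟩ := exists_lift_of_ofHom_eq_zero
      (f := pushoutInl b j ∘ₗ h) hb (LinearMap.range (b.prod j)).mkQ (Submodule.mkQ_surjective _)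
    have hinj : Function.Injective (b.prod j) := fun x y hxy => hj (congrArg Prod.snd hxy)
    have hmem : ∀ z, (LinearMap.inl R N L ∘ₗ h - t ∘ₗ s) z ∈ LinearMap.range (b.prod j) :=
      fun z => by
        rw [← Submodule.ker_mkQ (LinearMap.range (b.prod j)), LinearMap.mem_ker,
          LinearMap.sub_apply, map_sub, sub_eq_zero]
        exact (LinearMap.congr_fun hst z).symm
    let g : Z →ₗ[R] M := (LinearEquiv.ofInjective _ hinj).symm.toLinearMap ∘ₗ
      LinearMap.codRestrict _ (LinearMap.inl R N L ∘ₗ h - t ∘ₗ s) hmem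
    have hg : ∀ z, b.prod j (g z) = (LinearMap.inl R N L ∘ₗ h - t ∘ₗ s) z := fun z =>
      LinearEquiv.ofInjective_symm_apply (b.prod j) (h := hinj) ⟨_, hmem z⟩
    have : b ∘ₗ g = h - (LinearMap.fst R N L ∘ₗ t) ∘ₗ s := by
      ext z
      simpa using congrArg Prod.fst (hg z)
    refine ⟨ofHom g, ?_⟩
    rw [← ofHom_comp, this, ofHom_sub, ofHom_comp_eq_zero, sub_zero]
  · rintro ⟨g, hg⟩
    rw [← hg, Category.assoc, ← ofHom_comp]
    have : pushoutInl b j ∘ₗ b =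
        (-(LinearMap.range (b.prod j)).mkQ ∘ₗ LinearMap.inr R N L) ∘ₗ j := by
      ext x
      have : (LinearMap.range (b.prod j)).mkQ (b x, j x) = 0 := by
        rw [← LinearMap.mem_ker, Submodule.ker_mkQ]
        exact ⟨x, rfl⟩
      have h' : (b x, j x) = LinearMap.inl R N L (b x) + LinearMap.inr R N L (j x) := by simp
      rw [h', map_add, add_eq_zero_iff_eq_neg] at this
      exact this
    rw [this, ofHom_comp_eq_zero, comp_zero]

end

instance : AdmitsWeakKernels (StableMod R) where
  exists_isWeakKernel {X Y} f := by
    induction X using induction_on with | _ X => ?_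
    induction Y using induction_on with | _ Y => ?_
    obtain ⟨f, rfl⟩ := ofHom_surjective f
    obtain ⟨n, π, hπ⟩ := Module.Finite.exists_fin' R Y
    exact ⟨_, _, isWeakKernel_pullbackFst f π hπ⟩

theorem hasFrobeniusWeakKernels
    (hinj : ∀ (P : FGModuleCat.{u} R), Module.Projective R P → Module.Injective R P)
    (hemb : ∀ M : FGModuleCat.{u} R, ∃ (n : ℕ) (j : M →ₗ[R] Fin n → R), Function.Injective j) :
    HasFrobeniusWeakKernels (StableMod R) := by
  intro B C b
  induction B using induction_on with | _ B => ?_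
  induction C using induction_on with | _ C => ?_
  obtain ⟨b, rfl⟩ := ofHom_surjective b
  obtain ⟨n, π, hπ⟩ := Module.Finite.exists_fin' R C
  obtain ⟨m, j, hj⟩ := hemb (FGModuleCat.of R B)
  exact ⟨⟨_, _, isWeakKernel_pullbackFst b π hπ, fun X f hf =>
    exists_factorization_of_pullbackFst_comp b π hπ hinj f hf⟩, _, _, isWeakKernel_pushoutInl b j hj⟩

end StableMod

end StableMod

/-! ### Self-injective local rings -/

section SelfInjective

open IsLocalRing

variable {R : Type u} [CommRing R] [IsLocalRing R]

variable (R) in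
theorem IsLocalRing.exists_maximalIdeal_pow_eq_bot [IsArtinianRing R] :
    ∃ n, maximalIdeal R ^ n = ⊥ := by
  have := IsArtinianRing.isNilpotent_jacobson_bot (R := R)
  rwa [IsLocalRing.jacobson_eq_maximalIdeal ⊥ bot_ne_top] at this

theorem IsLocalRing.exists_socle_element [IsArtinianRing R] :
    ∃ s : R, s ≠ 0 ∧ ∀ r ∈ maximalIdeal R, r * s = 0 := by
  have hnil := exists_maximalIdeal_pow_eq_bot R
  classical
  have hpos : Nat.find hnil ≠ 0 := fun h => by
    have := Nat.find_spec hnil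
    rw [h, pow_zero, Ideal.one_eq_top] at this
    exact top_ne_bot this
  obtain ⟨k, hk⟩ := Nat.exists_eq_succ_of_ne_zero hpos
  obtain ⟨s, hs, hs0⟩ := Submodule.exists_mem_ne_zero_of_ne_bot
    (Nat.find_min hnil (m := k) (by omega))
  refine ⟨s, hs0, fun r hr => ?_⟩
  have h := Nat.find_spec hnil
  rw [hk, pow_succ'] at h
  have := Ideal.mul_mem_mul hr hs
  rwa [h] at this

/-- The maximal ideal is nil: once the annihilators of powers of x stabilise, self-injectivity makes
x^n a multiple of x^(2n+1), and x^n(1 - x^(n+1)c) = 0 forces x^n = 0. -/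
theorem Module.Baer.isArtinianRing [IsNoetherianRing R] (h : Module.Baer R R) :
    IsArtinianRing R := by
  have hnil : ∀ x ∈ maximalIdeal R, IsNilpotent x := by
    intro x hx
    obtain ⟨n, hn⟩ := monotone_stabilizes_iff_noetherian.2 ‹IsNoetherianRing R›
      ⟨fun n => LinearMap.ker (LinearMap.mulLeft R (x ^ n)), monotone_nat_of_le_succ fun n r hr => by
        simp only [LinearMap.mem_ker, LinearMap.mulLeft_apply] at hr ⊢
        rw [pow_succ', mul_assoc, hr, mul_zero]⟩
    -- The gap n + 1 is positive even for n = 0, so x^(n+1) lies in the maximal ideal.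
    have hker : LinearMap.ker (LinearMap.mulLeft R (x ^ n)) =
        LinearMap.ker (LinearMap.mulLeft R (x ^ (n + (n + 1)))) := hn _ (by omega)
    obtain ⟨g, hg⟩ := Module.Baer.extension_property h
      ((LinearMap.ker (LinearMap.mulLeft R (x ^ (n + (n + 1))))).liftQ
        (LinearMap.mulLeft R (x ^ (n + (n + 1)))) le_rfl)
      (LinearMap.ker_eq_bot.1 (Submodule.ker_liftQ_eq_bot _ _ _ le_rfl))
      ((LinearMap.ker (LinearMap.mulLeft R (x ^ (n + (n + 1))))).liftQ
        (LinearMap.mulLeft R (x ^ n)) hker.ge)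
    have h₁ := LinearMap.congr_fun hg (Submodule.Quotient.mk 1)
    simp only [LinearMap.comp_apply, Submodule.liftQ_apply, LinearMap.mulLeft_apply, mul_one] at h₁
    have h₂ : g (x ^ (n + (n + 1))) = x ^ (n + (n + 1)) * g 1 := by
      rw [← smul_eq_mul, ← map_smul, smul_eq_mul, mul_one]
    have hu : IsUnit (1 - x ^ (n + 1) * g 1) :=
      isUnit_one_sub_self_of_mem_nonunits _ ((mem_maximalIdeal _).1
        (Ideal.mul_mem_right _ _ (Ideal.pow_mem_of_mem _ hx _ (by omega))))
    refine ⟨n, (hu.mul_left_eq_zero).1 ?_⟩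
    rw [mul_sub, mul_one, ← mul_assoc, ← pow_add, ← h₂, h₁, sub_self]
  have hiff : ∀ x : R, IsNilpotent x ↔ ¬ IsUnit x := fun x =>
    ⟨fun hx hu => hx.not_isUnit hu, hnil x⟩
  have hdim : Ring.KrullDimLE 0 R ∧ IsLocalRing R ↔ ∀ x : R, IsNilpotent x ↔ ¬ IsUnit x :=
    (Ring.krullDimLE_zero_and_isLocalRing_tfae R).out 0 2
  have := (hdim.2 hiff).1
  exact IsNoetherianRing.isArtinianRing_of_krullDimLE_zero

variable [IsArtinianRing R] [Module.Injective R R]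

/-- The annihilator of x lies in the maximal ideal, which kills a socle element s; so x ↦ s is
defined on Rx and extends to M. -/
theorem Module.exists_dual_ne_zero_of_injective {M : Type u} [AddCommGroup M] [Module R M] {x : M}
    (hx : x ≠ 0) : ∃ f : M →ₗ[R] R, f x ≠ 0 := by
  obtain ⟨s, hs, hms⟩ := exists_socle_element (R := R)
  have hle : LinearMap.ker (LinearMap.toSpanSingleton R M x) ≤
      LinearMap.ker (LinearMap.toSpanSingleton R R s) := fun r hr => by
    refine hms r ((mem_maximalIdeal _).2 fun hu => hx ?_)
    exact hu.smul_eq_zero.1 hr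
  obtain ⟨f, hf⟩ := Module.Injective.out (Submodule.liftQ _ (LinearMap.toSpanSingleton R M x) le_rfl)
    (LinearMap.ker_eq_bot.1 (Submodule.ker_liftQ_eq_bot _ _ _ le_rfl)) (Submodule.liftQ _ _ hle)
  refine ⟨f, ?_⟩
  have := hf (Submodule.Quotient.mk 1)
  simp only [Submodule.liftQ_apply, LinearMap.toSpanSingleton_apply, one_smul] at this
  rwa [this]

/-- Take a map to a free module with minimal kernel; a functional nonzero on a kernel element would
shrink it. -/
theorem Module.Finite.exists_injective_fin_of_injective (M : Type u) [AddCommGroup M] [Module R M]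
    [Module.Finite R M] : ∃ (n : ℕ) (j : M →ₗ[R] Fin n → R), Function.Injective j := by
  have : IsArtinian R M := inferInstance
  have hne : {K : Submodule R M |
      ∃ (n : ℕ) (j : M →ₗ[R] Fin n → R), LinearMap.ker j = K}.Nonempty :=
    ⟨_, 0, 0, rfl⟩
  obtain ⟨_, ⟨n, j, rfl⟩, hmin⟩ := (wellFounded_lt (α := Submodule R M)).has_min _ hne
  refine ⟨n, j, LinearMap.ker_eq_bot.1 ((Submodule.eq_bot_iff _).2 fun x hx => ?_)⟩
  by_contra hx0
  obtain ⟨f, hf⟩ := Module.exists_dual_ne_zero_of_injective (R := R) hx0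
  let j' : M →ₗ[R] Fin (n + 1) → R :=
    LinearMap.pi (Fin.cons f fun i => LinearMap.proj i ∘ₗ j)
  have hj' : ∀ y, j' y = 0 ↔ f y = 0 ∧ j y = 0 := fun y => by
    simp [j', funext_iff, Fin.forall_fin_succ]
  refine hmin _ ⟨n + 1, j', rfl⟩ (lt_of_le_of_ne (fun y hy => ((hj' y).1 hy).2) fun h => hf ?_)
  rw [← h] at hx
  exact ((hj' x).1 hx).1

omit [IsLocalRing R] [IsArtinianRing R] in
theorem Module.Injective.of_projective_of_finite (P : Type u) [AddCommGroup P] [Module R P]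
    [Module.Finite R P] [Module.Projective R P] : Module.Injective R P where
  out X Y _ _ _ _ f hf g := by
    obtain ⟨n, π, hπ⟩ := Module.Finite.exists_fin' R P
    obtain ⟨s, hs⟩ := Module.projective_lifting_property π LinearMap.id hπ
    obtain ⟨h, hh⟩ := Module.Injective.out f hf (s ∘ₗ g)
    exact ⟨π ∘ₗ h, fun x => by
      rw [LinearMap.comp_apply, hh]; exact LinearMap.congr_fun hs (g x)⟩

end SelfInjective

/-! ### Finite injective dimension over an artinian local ring -/

section InjectiveDimension

open IsLocalRing

open Abelian

variable {R : Type u} [CommRing R] [IsLocalRing R]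

theorem exists_injective_finsupp_of_maximalIdeal_smul_eq_zero [IsArtinianRing R] (Y : Type u)
    [AddCommGroup Y] [Module R Y] (hY : ∀ r ∈ maximalIdeal R, ∀ y : Y, r • y = 0) :
    ∃ (ι : Type u) (f : Y →ₗ[R] ι →₀ R), Function.Injective f := by
  obtain ⟨s, hs, hms⟩ := exists_socle_element (R := R)
  have ht : Module.IsTorsionBySet R Y (maximalIdeal R) := fun y r => hY r r.2 y
  let := ht.module
  let := Ideal.Quotient.field (maximalIdeal R)
  let g : (R ⧸ maximalIdeal R) →ₗ[R] R := Submodule.liftQ _ (LinearMap.toSpanSingleton R R s) hms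
  have hg : Function.Injective g := by
    refine LinearMap.ker_eq_bot.1 (Submodule.ker_liftQ_eq_bot _ _ _ fun r hr => ?_)
    exact (mem_maximalIdeal _).2 fun hu => hs ((hu.mul_right_eq_zero).1 hr)
  let B := Module.Basis.ofVectorSpace (R ⧸ maximalIdeal R) Y
  refine ⟨_, Finsupp.mapRange.linearMap g ∘ₗ (B.repr.toLinearMap.restrictScalars R), ?_⟩
  exact (Finsupp.mapRange_injective g (map_zero g) hg).comp B.repr.injective

omit [IsLocalRing R] in
theorem shortExact_mkQ {Y Z : Type u} [AddCommGroup Y] [Module R Y] [AddCommGroup Z] [Module R Z]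
    (f : Y →ₗ[R] Z) (hf : Function.Injective f) :
    (ModuleCat.shortComplexOfCompEqZero f (LinearMap.range f).mkQ
      f.exact_map_mkQ_range.linearMap_comp_eq_zero).ShortExact :=
  ModuleCat.shortComplex_shortExact _ f.exact_map_mkQ_range hf (Submodule.mkQ_surjective _)

/-- Induct along mY ⊂ Y. The quotient Y/mY is a sum of copies of the residue field, which embeds in
R via the socle. So Y/mY embeds in a free module, and its Ext^(n+1) sits between Ext^(n+1) of that
free module and Ext^(n+2) of the cokernel, both zero. -/
theorem ext_eq_zero_of_pow_smul_eq_zero [IsArtinianRing R] {n : ℕ}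
    (h : HasInjectiveDimensionLT (ModuleCat.of R R) (n + 2)) (k : ℕ) :
    ∀ (Y : Type u) [AddCommGroup Y] [Module R Y]
      (_ : ∀ r ∈ maximalIdeal R ^ k, ∀ y : Y, r • y = 0)
      (e : Ext (ModuleCat.of R Y) (ModuleCat.of R R) (n + 1)), e = 0 := by
  induction k with
  | zero =>
    intro Y _ _ hY e
    have : Subsingleton Y := ⟨fun a b => by
      rw [← one_smul R a, ← one_smul R b, hY 1 (by simp), hY 1 (by simp)]⟩
    have : Projective (ModuleCat.of R Y) :=
      (IsProjective.iff_projective (R := R) Y).1 inferInstance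
    exact e.eq_zero_of_projective
  | succ k ih =>
    intro Y _ _ hY e
    have hS := shortExact_mkQ (maximalIdeal R • (⊤ : Submodule R Y)).subtype
      (Submodule.injective_subtype _)
    obtain ⟨x, rfl⟩ := Ext.contravariant_sequence_exact₂ hS _ e (ih _ (fun r hr y => by
      have hle : maximalIdeal R • (⊤ : Submodule R Y) ≤ LinearMap.ker (LinearMap.lsmul R Y r) :=
        Submodule.smul_le.2 fun a ha z _ => by
          rw [LinearMap.mem_ker, LinearMap.lsmul_apply, smul_smul]
          exact hY _ (by rw [pow_succ]; exact Ideal.mul_mem_mul hr ha) z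
      exact Subtype.ext (hle y.2)) _)
    have hx : x = 0 := by
      obtain ⟨ι, f, hf⟩ := exists_injective_finsupp_of_maximalIdeal_smul_eq_zero
        (R := R) (Y ⧸ LinearMap.range (maximalIdeal R • (⊤ : Submodule R Y)).subtype) (fun r hr y => by
          obtain ⟨z, rfl⟩ := Submodule.Quotient.mk_surjective _ y
          rw [← Submodule.Quotient.mk_smul, Submodule.Quotient.mk_eq_zero, Submodule.range_subtype]
          exact Submodule.smul_mem_smul hr trivial)
      have hT := shortExact_mkQ f hf
      have : Projective (ModuleCat.of R (ι →₀ R)) :=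
        (IsProjective.iff_projective (R := R) (ι →₀ R)).1 inferInstance
      obtain ⟨z, hz⟩ := Ext.contravariant_sequence_exact₁ hT _ x (add_comm 1 (n + 1))
        (Ext.eq_zero_of_hasInjectiveDimensionLT _ (n + 2) le_rfl)
      have hz0 : z = 0 := Ext.eq_zero_of_projective (P := ModuleCat.of R (ι →₀ R)) z
      rw [← hz, hz0, Ext.comp_zero]
    rw [hx, Ext.comp_zero]

theorem injective_of_hasInjectiveDimensionLE [IsArtinianRing R] (n : ℕ)
    (h : HasInjectiveDimensionLE (ModuleCat.of R R) n) : Module.Injective R R := by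
  induction n with
  | zero =>
    have : HasInjectiveDimensionLT (ModuleCat.of R R) 1 := h
    have : Injective (ModuleCat.of R R) := inferInstance
    exact Module.injective_module_of_injective_object R R
  | succ n ih =>
    refine ih (HasInjectiveDimensionLT.mk fun i hi Y e => ?_)
    obtain rfl | hi := hi.eq_or_lt
    · obtain ⟨k, hk⟩ := exists_maximalIdeal_pow_eq_bot R
      exact ext_eq_zero_of_pow_smul_eq_zero h k Y (fun r hr y => by
        rw [hk, Ideal.mem_bot] at hr
        rw [hr, zero_smul]) e
    · exact Ext.eq_zero_of_hasInjectiveDimensionLT e (n + 2) hi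

end InjectiveDimension

/-! ### Injective representables force self-injectivity -/

section Necessity

open IsLocalRing

variable {R : Type u} [CommRing R] [IsNoetherianRing R] [IsLocalRing R]

theorem StableMod.exists_dual_eq_one (h : ∀ X : StableMod R, Injective (ModCat.yoneda X))
    (E : Type u) [AddCommGroup E] [Module R E] [Module.Finite R E] (x : E)
    (hann : ∀ r : R, r • x = 0 → r = 0) (hx : x ∉ maximalIdeal R • (⊤ : Submodule R E)) :
    ∃ φ : E →ₗ[R] R, φ x = 1 := by
  set ξ := LinearMap.toSpanSingleton R E x with hξ
  have hξinj : Function.Injective ξ := (injective_iff_map_eq_zero ξ).2 hann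
  let p := (LinearMap.range ξ).mkQ
  have hp : Function.Surjective p := Submodule.mkQ_surjective _
  have := h (of R E)
  -- If p ∘ f factors through a projective, lift that factorization to E: the difference from f
  -- lands in Rx ≅ R, so f is stably zero.
  obtain ⟨q, hq⟩ := ModCat.exists_retraction (ofHom p) fun Z f hf => by
    induction Z using induction_on with | _ Z => ?_
    obtain ⟨f, rfl⟩ := ofHom_surjective f
    obtain ⟨P, _, a, b, hab⟩ := exists_lift_of_ofHom_eq_zero (f := p ∘ₗ f) hf p hp
    have hmem : ∀ z, (f - b ∘ₗ a) z ∈ LinearMap.range ξ := fun z => by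
      rw [← Submodule.ker_mkQ (LinearMap.range ξ), LinearMap.mem_ker, LinearMap.sub_apply, map_sub,
        sub_eq_zero]
      exact (LinearMap.congr_fun hab z).symm
    let g : Z →ₗ[R] R := (LinearEquiv.ofInjective ξ hξinj).symm.toLinearMap ∘ₗ
      LinearMap.codRestrict _ (f - b ∘ₗ a) hmem
    have hg : ξ ∘ₗ g = f - b ∘ₗ a := LinearMap.ext fun z =>
      LinearEquiv.ofInjective_symm_apply ξ (h := hξinj) ⟨_, hmem z⟩
    have := ofHom_comp_eq_zero R g ξ
    rwa [hg, ofHom_sub, ofHom_comp_eq_zero, sub_zero] at this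
  obtain ⟨q, rfl⟩ := ofHom_surjective q
  have hid : ofHom (LinearMap.id - q ∘ₗ p) = 0 := by
    rw [ofHom_sub, ofHom_comp, hq, ofHom_id, sub_self]
  obtain ⟨n, π, hπ⟩ := Module.Finite.exists_fin' R E
  obtain ⟨P, _, a, b, hab⟩ := exists_lift_of_ofHom_eq_zero hid π hπ
  have hpx : p x = 0 := by
    rw [← LinearMap.mem_ker, Submodule.ker_mkQ]
    exact ⟨1, one_smul R x⟩
  have hxx : π (b (a x)) = x := by simpa [hpx] using LinearMap.congr_fun hab x
  by_cases hu : ∃ i, IsUnit (b (a x) i)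
  · obtain ⟨i, hi⟩ := hu
    refine ⟨(↑hi.unit⁻¹ : R) • (LinearMap.proj i ∘ₗ b ∘ₗ a), ?_⟩
    exact hi.val_inv_mul
  · refine absurd ?_ hx
    rw [← hxx, LinearMap.pi_apply_eq_sum_univ π]
    refine Submodule.sum_mem _ fun i _ => Submodule.smul_mem_smul ?_ trivial
    exact (mem_maximalIdeal _).2 fun hi => hu ⟨i, hi⟩

theorem notMem_maximalIdeal_smul_top {E : Type u} [AddCommGroup E] [Module R E]
    (ψ : E →ₗ[R] R ⧸ maximalIdeal R) {x : E} (hx : ψ x = 1) :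
    x ∉ maximalIdeal R • (⊤ : Submodule R E) := by
  intro hmem
  have hle : maximalIdeal R • (⊤ : Submodule R E) ≤ LinearMap.ker ψ :=
    Submodule.smul_le.2 fun r hr y _ => by
      obtain ⟨s, hs⟩ := Ideal.Quotient.mk_surjective (ψ y)
      rw [LinearMap.mem_ker, map_smul, ← hs, Algebra.smul_def, Ideal.Quotient.algebraMap_eq,
        Ideal.Quotient.eq_zero_iff_mem.2 hr, zero_mul]
  have := hle hmem
  rw [LinearMap.mem_ker, hx] at this
  exact one_ne_zero this

section

variable (H : ∀ (E : Type u) [AddCommGroup E] [Module R E] [Module.Finite R E] (x : E),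
  (∀ r : R, r • x = 0 → r = 0) → x ∉ maximalIdeal R • (⊤ : Submodule R E) →
    ∃ φ : E →ₗ[R] R, φ x = 1)

include H

theorem exists_socle_element_of_exists_dual :
    ∃ s : R, s ≠ 0 ∧ ∀ r ∈ maximalIdeal R, r * s = 0 := by
  by_contra! hcon
  have hsoc : ∀ s : R, (∀ r ∈ maximalIdeal R, r * s = 0) → s = 0 := fun s hs => by
    by_contra hs0
    obtain ⟨r, hr, hrs⟩ := hcon s hs0
    exact hrs (hs r hr)
  obtain ⟨n, t, ht⟩ := Submodule.fg_iff_exists_fin_generating_family.1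
    (IsNoetherian.noetherian (maximalIdeal R))
  have htm : ∀ i, t i ∈ maximalIdeal R := fun i => ht ▸ Submodule.subset_span ⟨i, rfl⟩
  -- With zero socle, the generators `t` of the maximal ideal make (t, 1) faithful, and the 1 keeps
  -- it outside mE. But `φ` kills the residue field and sends `t` into the maximal ideal.
  obtain ⟨φ, hφ⟩ := H ((Fin n → R) × (R ⧸ maximalIdeal R)) (t, 1)
    (fun r hr => hsoc r fun a ha => by
      have hle : maximalIdeal R ≤ LinearMap.ker (LinearMap.mulLeft R r) := by
        rw [← ht, Submodule.span_le]
        rintro _ ⟨i, rfl⟩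
        exact congrFun (congrArg Prod.fst hr) i
      rw [mul_comm]
      exact hle ha)
    (notMem_maximalIdeal_smul_top (LinearMap.snd _ _ _) rfl)
  have h₀ : φ (0, 1) = 0 := hsoc _ fun r hr => by
    rw [← smul_eq_mul, ← map_smul, Prod.smul_mk, smul_zero, Algebra.smul_def,
      Ideal.Quotient.algebraMap_eq, Ideal.Quotient.eq_zero_iff_mem.2 hr, zero_mul]
    exact map_zero φ
  have h₁ : φ (t, 0) ∈ maximalIdeal R := by
    change (φ ∘ₗ LinearMap.inl R _ _) t ∈ _
    rw [LinearMap.pi_apply_eq_sum_univ]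
    exact Submodule.sum_mem _ fun i _ => Ideal.mul_mem_right _ _ (htm i)
  have h₂ : φ (t, 1) = φ (t, 0) + φ (0, 1) := by
    rw [← map_add, Prod.mk_add_mk, add_zero, zero_add]
  rw [hφ, h₀, add_zero] at h₂
  rw [← h₂] at h₁
  exact (Ideal.ne_top_iff_one _).1 (maximalIdeal.isMaximal R).ne_top h₁

/-- Extending f : I → R amounts to retracting R → (R × R)/N, the pushout of I ⊂ R along f; `H`
applied to the class of (0, 1) gives the retraction. -/
theorem baer_of_exists_dual : Module.Baer R R := by
  intro I f
  obtain rfl | hI := eq_or_ne I ⊤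
  · refine ⟨f ∘ₗ (LinearMap.id).codRestrict ⊤ fun _ => trivial, fun x _ => rfl⟩
  obtain ⟨s, hs, hms⟩ := exists_socle_element_of_exists_dual H
  -- A socle element kills the proper ideal I, hence f(I), so no f(i) is a unit. This keeps the
  -- class of (0, 1) outside mE.
  have hfm : ∀ i, f i ∈ maximalIdeal R := fun i => (mem_maximalIdeal _).2 fun hu => hs (by
    have : s • i = 0 := Subtype.ext (by
      rw [Submodule.coe_smul, smul_eq_mul, mul_comm]
      exact hms _ (le_maximalIdeal hI i.2))
    have h := map_smul f s i
    rw [this, map_zero, smul_eq_mul, eq_comm] at h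
    exact hu.mul_left_eq_zero.1 h)
  let N := LinearMap.range (I.subtype.prod (-f))
  obtain ⟨φ, hφ⟩ := H ((R × R) ⧸ N) (N.mkQ (0, 1))
    (fun r hr => by
      rw [← map_smul, ← LinearMap.mem_ker, Submodule.ker_mkQ] at hr
      obtain ⟨i, hi⟩ := hr
      have h₁ : (i : R) = r * 0 := congrArg Prod.fst hi
      have h₂ : -f i = r * 1 := congrArg Prod.snd hi
      have : i = 0 := Subtype.ext (by rw [h₁, mul_zero]; rfl)
      rw [this, map_zero, neg_zero, mul_one] at h₂
      exact h₂.symm)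
    (notMem_maximalIdeal_smul_top
      (N.liftQ ((maximalIdeal R).mkQ ∘ₗ LinearMap.snd R R R) (by
        rintro _ ⟨i, rfl⟩
        rw [LinearMap.mem_ker]
        exact (Submodule.Quotient.mk_eq_zero _).2 (neg_mem (hfm i)))) rfl)
  refine ⟨φ ∘ₗ N.mkQ ∘ₗ LinearMap.inl R R R, fun x hx => ?_⟩
  have h₀ : N.mkQ (x, -f ⟨x, hx⟩) = 0 := by
    rw [← LinearMap.mem_ker, Submodule.ker_mkQ]
    exact ⟨⟨x, hx⟩, rfl⟩
  have h₁ : (x, -f ⟨x, hx⟩) = ((x, 0) - f ⟨x, hx⟩ • (0, 1) : R × R) := by simp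
  rw [h₁, map_sub, map_smul, sub_eq_zero] at h₀
  change φ (N.mkQ (x, 0)) = _
  rw [h₀, map_smul, hφ, smul_eq_mul, mul_one]

end

end Necessity

theorem mainTheorem6 (R : Type u) [CommRing R] [IsNoetherianRing R] [HenselianLocalRing R] :
    List.TFAE
      [IsQuasiFrobeniusCategory (ModCat (StableMod R)),
        IsFrobeniusCategory (ModCat (StableMod R)),
        IsArtinianRing R ∧ IsGorensteinLocalRing R] := by
  tfae_have 2 → 1 := fun h => ⟨h.abelian, h.enoughProjectives, h.injective_of_projective⟩
  tfae_have 1 → 3 := fun h => by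
    have hbaer : Module.Baer R R := baer_of_exists_dual fun E _ _ _ x =>
      StableMod.exists_dual_eq_one (fun X => h.injective_of_projective _ inferInstance) E x
    have : Module.Injective R R := hbaer.injective
    have : Injective (ModuleCat.of R R) := Module.injective_object_of_injective_module R R
    exact ⟨hbaer.isArtinianRing, inferInstance, 0,
      inferInstanceAs (HasInjectiveDimensionLT (ModuleCat.of R R) 1)⟩
  tfae_have 3 → 2 := by
    rintro ⟨_, _, n, hn⟩
    have := injective_of_hasInjectiveDimensionLE n hn
    exact ModCat.isFrobeniusCategory (StableMod.hasFrobeniusWeakKernels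
      (fun P _ => Module.Injective.of_projective_of_finite P)
      fun M => Module.Finite.exists_injective_fin_of_injective M)
  tfae_finish
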